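/- Let $n\ge 1$. For a binary sequence $x=x_1\cdots x_n\in\{0,1\}^n$ put $\mathrm{VT}^0(x)=\sum_{i=1}^n x_i$ and $\mathrm{VT}^k(x)=\sum_{i=1}^n\sum_{j=1}^i j^{k-1}x_i$ for $k\ge 1$. Let $\mathcal B(x)\subseteq\{0,1\}^{n-1}$ be the single-deletion single-substitution ball of $x$: the set of all sequences obtained from $x$ by deleting exactly one entry and then changing at most one entry. A set $\mathcal C\subseteq\{0,1\}^n$ is an $(n,N;\mathcal B)$-reconstruction code if $|\mathcal B(x)\cap\mathcal B(y)|<N$ for any two distinct $x,y\in\mathcal C$; the redundancy of a nonempty $\mathcal C$ is $n-\log_2|\mathcal C|$. For integers $0\le s_0\le 3$, $0\le s_1\le 2n-1$ and $0\le s_2\le 2n^2-1$ let $$\mathcal C_L=\big\{x\in\{0,1\}^n:\ \mathrm{VT}^0(x)\equiv s_0\pmod 4,\ \ \mathrm{VT}^k(x)\equiv s_k\pmod{2n^k}\text{ for }k=1,2\big\}.$$ Then, for every such choice of $s_0,s_1,s_2$, the code $\mathcal C_L$ is an $(n,5;\mathcal B)$-reconstruction code. Moreover, there is a choice of $s_0,s_1,s_2$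 in these ranges for which $\mathcal C_L$ is nonempty and has redundancy at most $3\log_2 n+4$. -/

import Mathlib

/-- Binary sequences of length `n`, with `false` for `0` and `true` for `1`. The entry at the
(one-based) position `i + 1` of `x` is `x i`. -/
abbrev BinSeq (n : ℕ) : Type := Fin n → Bool

namespace BinSeq

/-- `y` is a subsequence of `x`: it is read off from `x` along strictly increasing positions. -/
def IsSubsequence {m n : ℕ} (y : BinSeq m) (x : BinSeq n) : Prop :=
  ∃ f : Fin m → Fin n, StrictMono f ∧ ∀ i, y i = x (f i)

/-- The single-deletion ball. -/
def deletionBall {n : ℕ} (x : BinSeq n) : Set (BinSeq (n - 1)) :=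
  {y | IsSubsequence y x}

/-- The single-substitution ball. -/
def substitutionBall {n : ℕ} (x : BinSeq n) : Set (BinSeq n) :=
  {y | hammingDist x y ≤ 1}

/-- The single-deletion single-substitution ball: all sequences obtained from `x` by one deletion
followed by one substitution (a substitution may leave the sequence unchanged). -/
def deletionSubstitutionBall {n : ℕ} (x : BinSeq n) : Set (BinSeq (n - 1)) :=
  {z | ∃ y ∈ deletionBall x, z ∈ substitutionBall y}

/-- The number of ones. -/
def weight {n : ℕ} (x : BinSeq n) : ℕ := ∑ i, (x i).toNat

/-- The `k`-th order VT syndrome: the weight for `k = 0`, and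
`∑_{i=1}^n ∑_{j=1}^i j^(k-1) x_i` for `k ≥ 1`. -/
def vtSyndrome {n : ℕ} : ℕ → BinSeq n → ℕ
  | 0, x => weight x
  | k + 1, x => ∑ i : Fin n, ∑ j ∈ Finset.Icc 1 ((i : ℕ) + 1), j ^ k * (x i).toNat

end BinSeq

/-- `C` is an `(n, N; B)`-reconstruction code, where `B` is the single-deletion
single-substitution ball. -/
def IsReconstructionCode (n N : ℕ) (C : Set (BinSeq n)) : Prop :=
  ∀ x ∈ C, ∀ y ∈ C, x ≠ y →
    (x.deletionSubstitutionBall ∩ y.deletionSubstitutionBall).ncard < N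

/-- The redundancy `n - log₂ |C|` of a nonempty code `C` of length `n`. -/
noncomputable def redundancy {n : ℕ} (C : Set (BinSeq n)) : ℝ :=
  (n : ℝ) - Real.logb 2 (C.ncard : ℝ)

/-- The code given by `VT⁰(x) ≡ s₀ (mod 4)` and `VTᵏ(x) ≡ sₖ (mod 2nᵏ)` for `k = 1, 2`. -/
def listDecodableCode (n s₀ s₁ s₂ : ℕ) : Set (BinSeq n) :=
  {x | x.vtSyndrome 0 ≡ s₀ [MOD 4] ∧
       x.vtSyndrome 1 ≡ s₁ [MOD 2 * n ^ 1] ∧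
       x.vtSyndrome 2 ≡ s₂ [MOD 2 * n ^ 2]}

/-! Let `T` be the difference of the prefix sums of `x` and `y`. If `x` and `y` have a common
descendant, `T` ends at 0 and `|T| ≤ 2`; summation by parts turns the two higher congruences into
congruences for the moments of `T`, which are too small to be nonzero multiples of the moduli
(`vanishingMoments_prefixDiff`). A nonzero `T` with two vanishing moments changes sign at least
twice (`VanishingMoments.eq_zero`).

Suppose a descendant arises by deleting entry `i` of `x` and entry `j` of `y`, with `i ≤ j`. The
deletions alone give `T` a constant sign on `(i, j]`, so two sign changes force both substitutions
to be genuine, to have the same `α`, and to act together on an interval strictly inside; moreover `x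
i = y j` (`exists_straddle`). The sign pattern of `T` and the value `x i` then determine whether `i
≤ j` or `j ≤ i`, and for a given pair `(x i, α)` the descendant is unique (`eq_of_same_direction`).
The weight of the descendant determines `x i + α`, which takes different values on the four pairs.
Hence weight is injective on common descendants and takes at most four values there.

The redundancy bound is pigeonhole over `4 * 2n * 2n² = 16n³` residue classes. -/

/-! ### One deletion and one substitution on integer sequences -/

/-- `z` arises from `x` by deleting entry `i` and then subtracting `α` from entry `s`. -/
def DelSub (x z : ℕ → ℤ) (i s : ℕ) (α : ℤ) : Prop :=
  (∀ k < i, x k = z k + if k = s then α else 0) ∧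
    ∀ k, i ≤ k → x (k + 1) = z k + if k = s then α else 0

/-- The difference of the prefix sums of `x` and `y`. -/
def prefixDiff (x y : ℕ → ℤ) (k : ℕ) : ℤ := ∑ l ∈ Finset.range k, (x l - y l)

/-- The position, before the deletion of entry `i`, of entry `s` of the shortened sequence. -/
def liftPos (i s : ℕ) : ℕ := if s < i then s else s + 1

lemma prefixDiff_succ (x y : ℕ → ℤ) (k : ℕ) :
    prefixDiff x y (k + 1) = prefixDiff x y k + (x k - y k) :=
  Finset.sum_range_succ _ _

lemma prefixDiff_swap (x y : ℕ → ℤ) (k : ℕ) : prefixDiff y x k = -prefixDiff x y k := by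
  simp [prefixDiff]

lemma ite_lt_succ (m k : ℕ) (a : ℤ) :
    (if m < k + 1 then a else 0) = (if m < k then a else 0) + if k = m then a else 0 := by
  split_ifs <;> omega

/-- For `i < k ≤ j` the first `k` entries of `x` are `x i` and `k - 1` entries of `z`, those of `y`
are `k - 1` entries of `z` and `y (k - 1)`, up to substitutions. Hence both substitution positions
are lifted through `i`, even the one made in `y`. -/
lemma prefixDiff_eq {x y z : ℕ → ℤ} {i j s t : ℕ} {α β : ℤ} (hij : i ≤ j)
    (hx : DelSub x z i s α) (hy : DelSub y z j t β) (k : ℕ) :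
    prefixDiff x y k = (if i < k ∧ k ≤ j then x i - y (k - 1) else 0) +
      (if liftPos i s < k then α else 0) - (if liftPos i t < k then β else 0) +
      (if j < k then x i - y j else 0) := by
  obtain ⟨hx1, hx2⟩ := hx
  obtain ⟨hy1, hy2⟩ := hy
  have lt_iff : ∀ k s, k < i → (k = liftPos i s ↔ k = s) := by
    intro k s hk; unfold liftPos; split_ifs <;> omega
  have eq_iff : ∀ s, (i = liftPos i s) ↔ False := by
    intro s; simp only [iff_false]; unfold liftPos; split_ifs <;> omega
  have gt_iff : ∀ m s, i ≤ m → (m + 1 = liftPos i s ↔ m = s) := by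
    intro k s hk; unfold liftPos; split_ifs <;> omega
  induction k with
  | zero => simp [prefixDiff]
  | succ k ih =>
    rw [prefixDiff_succ, ih]
    simp only [ite_lt_succ, Nat.add_sub_cancel]
    rcases lt_trichotomy k i with hk | hk | hk
    · rw [hx1 k hk, hy1 k (by omega), if_neg (by omega), if_neg (by omega : ¬(i < k + 1 ∧ _)),
        if_neg (by omega : ¬ k = j)]
      simp only [lt_iff k _ hk]
      ring
    · subst hk
      simp only [eq_iff, if_false, lt_irrefl, false_and]
      rcases hij.eq_or_lt with h | h
      · subst h
        rw [if_neg (by omega : ¬(k < k + 1 ∧ _)), if_pos rfl]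
        ring
      · rw [if_neg (by omega : ¬ k = j), if_pos (by omega : k < k + 1 ∧ k + 1 ≤ j)]
        ring
    · obtain ⟨m, rfl⟩ : ∃ m, k = m + 1 := ⟨k - 1, by omega⟩
      have h1 := hx2 m (by omega)
      simp only [gt_iff m _ (show i ≤ m by omega), Nat.add_sub_cancel]
      rcases lt_trichotomy (m + 1) j with h | h | h
      · have h2 := hy1 m (by omega)
        rw [if_pos (by omega : i < m + 1 ∧ m + 1 ≤ j),
          if_pos (by omega : i < m + 1 + 1 ∧ m + 1 + 1 ≤ j), if_neg (by omega : ¬ m + 1 = j)]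
        linarith
      · have h2 := hy1 m (by omega)
        subst h
        rw [if_pos (by omega : i < m + 1 ∧ m + 1 ≤ m + 1),
          if_neg (by omega : ¬(i < m + 1 + 1 ∧ _)), if_pos rfl]
        linarith
      · have h2 := hy2 m (by omega)
        rw [if_neg (by omega), if_neg (by omega : ¬(i < m + 1 + 1 ∧ _)),
          if_neg (by omega : ¬ m + 1 = j)]
        linarith

lemma DelSub.sum_range_eq {x z : ℕ → ℤ} {i s : ℕ} {α : ℤ} (h : DelSub x z i s α) (k : ℕ)
    (hk : i ≤ k) :
    ∑ l ∈ Finset.range (k + 1), x l =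
      ∑ l ∈ Finset.range k, z l + x i + if s < k then α else 0 := by
  have key : ∀ k ≤ i, ∑ l ∈ Finset.range k, x l =
      ∑ l ∈ Finset.range k, z l + if s < k then α else 0 := by
    intro k
    induction k with
    | zero => simp
    | succ k ih =>
      intro hk
      rw [Finset.sum_range_succ, Finset.sum_range_succ, ih (by omega), h.1 k (by omega)]
      split_ifs <;> omega
  induction k, hk using Nat.le_induction with
  | base => rw [Finset.sum_range_succ, key i le_rfl]; ring
  | succ k hk ih =>
    rw [Finset.sum_range_succ, ih, Finset.sum_range_succ, h.2 k hk]
    split_ifs <;> omega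

/-! ### Sign changes of sequences with two vanishing moments -/

/-- A sequence supported on `[0, n)` whose moments of order `0` and `1` vanish. -/
structure VanishingMoments (n : ℕ) (T : ℕ → ℤ) : Prop where
  zero_of_le : ∀ k, n ≤ k → T k = 0
  sum_zero : ∑ k ∈ Finset.range n, T k = 0
  sum_mul_zero : ∑ k ∈ Finset.range n, ((k : ℤ) + 1) * T k = 0

lemma VanishingMoments.neg {n : ℕ} {T : ℕ → ℤ} (h : VanishingMoments n T) : VanishingMoments n (fun k => -T k) where
  zero_of_le k hk := by simp [h.zero_of_le k hk]
  sum_zero := by simp [h.sum_zero]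
  sum_mul_zero := by simp [h.sum_mul_zero]

/-- A balanced sequence with at most one sign change vanishes. -/
lemma VanishingMoments.eq_zero {n : ℕ} {T : ℕ → ℤ} (h : VanishingMoments n T) {σ : ℤ} (hσ : σ = 1 ∨ σ = -1)
    (c : ℕ) (h1 : ∀ k < c, σ * T k ≤ 0) (h2 : ∀ k, c ≤ k → 0 ≤ σ * T k) (k : ℕ) : T k = 0 := by
  by_cases hk : n ≤ k
  · exact h.zero_of_le k hk
  -- The weight `2k + 1 - 2c` changes sign with `T` at `c` and, being odd, never vanishes. Its sum
  -- against `T` is a combination of the two moments.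
  have hnn : ∀ k ∈ Finset.range n, 0 ≤ (2 * (k : ℤ) + 1 - 2 * c) * (σ * T k) := by
    intro k _
    rcases lt_or_ge k c with hc | hc
    · exact mul_nonneg_of_nonpos_of_nonpos (by omega) (h1 k hc)
    · exact mul_nonneg (by omega) (h2 k hc)
  have hsum : ∑ k ∈ Finset.range n, (2 * (k : ℤ) + 1 - 2 * c) * (σ * T k) = 0 := by
    have e : ∀ k ∈ Finset.range n, (2 * (k : ℤ) + 1 - 2 * c) * (σ * T k) =
        2 * σ * (((k : ℤ) + 1) * T k) + (-(1 + 2 * c) * σ) * T k := by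
      intro k _; ring
    rw [Finset.sum_congr rfl e, Finset.sum_add_distrib, ← Finset.mul_sum, ← Finset.mul_sum,
      h.sum_zero, h.sum_mul_zero]
    simp
  have h0 := (Finset.sum_eq_zero_iff_of_nonneg hnn).1 hsum k (by simpa using hk)
  rcases mul_eq_zero.1 h0 with h0 | h0
  · omega
  · rcases hσ with rfl | rfl <;> omega

/-- `σ T` is nonpositive on `(p, q]` and nonnegative elsewhere. -/
def SignPattern (T : ℕ → ℤ) (σ : ℤ) (p q : ℕ) : Prop :=
  (∀ k, p < k → k ≤ q → σ * T k ≤ 0) ∧ ∀ k, ¬(p < k ∧ k ≤ q) → 0 ≤ σ * T k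

/-- Without a positive value on the left, only the sign change at `q` would remain. -/
lemma SignPattern.exists_pos_left {n : ℕ} {T : ℕ → ℤ} {σ : ℤ} {p q : ℕ} (h : SignPattern T σ p q)
    (hT : VanishingMoments n T) (hne : ∃ k, T k ≠ 0) (hσ : σ = 1 ∨ σ = -1) :
    ∃ k ≤ p, 0 < σ * T k := by
  by_contra! hc
  obtain ⟨k, hk⟩ := hne
  refine hk (hT.eq_zero hσ (max p q + 1) (fun k hk => ?_) (fun k hk => h.2 k (by omega)) k)
  rcases le_or_gt k p with h' | h'
  · exact hc k h'
  · exact h.1 k h' (by omega)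

lemma SignPattern.exists_pos_right {n : ℕ} {T : ℕ → ℤ} {σ : ℤ} {p q : ℕ}
    (h : SignPattern T σ p q) (hT : VanishingMoments n T) (hne : ∃ k, T k ≠ 0) (hσ : σ = 1 ∨ σ = -1) :
    ∃ k, q < k ∧ 0 < σ * T k := by
  by_contra! hc
  obtain ⟨k, hk⟩ := hne
  refine hk (hT.eq_zero (σ := -σ) (by omega) (p + 1) (fun k hk => ?_) (fun k hk => ?_) k)
  · have := h.2 k (by omega)
    linarith
  · rcases le_or_gt k q with h' | h'
    · have := h.1 k (by omega) h'
      linarith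
    · have := hc k h'
      linarith

lemma SignPattern.exists_neg {n : ℕ} {T : ℕ → ℤ} {σ : ℤ} {p q : ℕ}
    (h : SignPattern T σ p q) (hT : VanishingMoments n T) (hne : ∃ k, T k ≠ 0) (hσ : σ = 1 ∨ σ = -1) :
    ∃ k, p < k ∧ k ≤ q ∧ σ * T k < 0 := by
  by_contra! hc
  obtain ⟨k, hk⟩ := hne
  refine hk (hT.eq_zero hσ 0 (fun k hk => by omega) (fun k _ => ?_) k)
  by_cases h' : p < k ∧ k ≤ q
  · exact hc k h'.1 h'.2
  · exact h.2 k h'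

/-- A nonzero balanced sequence cannot have both of two opposite sign patterns. -/
lemma SignPattern.not_opposite {n : ℕ} {T : ℕ → ℤ} {σ : ℤ} {p q p' q' : ℕ}
    (h : SignPattern T σ p q) (h' : SignPattern T (-σ) p' q')
    (hT : VanishingMoments n T) (hne : ∃ k, T k ≠ 0) (hσ : σ = 1 ∨ σ = -1) : False := by
  obtain ⟨k, hk⟩ := hne
  -- Overlaying the two patterns leaves a single sign change, at `max q p'` or at `max q' p`.
  rcases le_total p p' with hp | hp
  · refine hk (hT.eq_zero hσ (max q p' + 1) (fun k hk => ?_) (fun k hk => h.2 k (by omega)) k)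
    rcases le_or_gt k p' with h1 | h1
    · have := h'.2 k (by omega)
      linarith
    · exact h.1 k (by omega) (by omega)
  · refine hk (hT.eq_zero (σ := -σ) (by omega) (max q' p + 1) (fun k hk => ?_)
      (fun k hk => h'.2 k (by omega)) k)
    rcases le_or_gt k p with h1 | h1
    · have := h.2 k (by omega)
      linarith
    · exact h'.1 k (by omega) (by omega)

/-! ### The shape of a common descendant of two sequences -/

/-- The prefix difference `T` against `y` is that of a move of an entry from `i` to `j`, corrected
on an interval `(p, q]` inside `(i, j]` by two substitutions. -/
structure Straddle (y T : ℕ → ℤ) (σ : ℤ) (i j p q : ℕ) : Prop where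
  lt_left : i < p
  lt_mid : p < q
  le_right : q ≤ j
  entry : 2 * y j = 1 + σ
  eq : ∀ k, T k = (if i < k ∧ k ≤ j then y j - y (k - 1) else 0) -
    if p < k ∧ k ≤ q then σ else 0

lemma Straddle.signPattern {y T : ℕ → ℤ} {σ : ℤ} {i j p q : ℕ} (h : Straddle y T σ i j p q)
    (hy : ∀ k, y k = 0 ∨ y k = 1) : SignPattern T σ p q := by
  have he := h.entry
  have h1 := h.lt_left
  have h2 := h.le_right
  have hσ : σ = 1 ∨ σ = -1 := by have := hy j; omega
  constructor
  · intro k hk hk'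
    rw [h.eq k, if_pos ⟨by omega, by omega⟩, if_pos ⟨hk, hk'⟩]
    have := hy (k - 1)
    rcases hσ with rfl | rfl <;> omega
  · intro k hk
    rw [h.eq k, if_neg hk]
    have := hy (k - 1)
    split_ifs
    · rcases hσ with rfl | rfl <;> omega
    · simp

/-- Since `σ * A` is 0 or 1, only `τ = -σ` can create negative values of `σ * T`. If the interval
reached an end of `(i, j]`, no positive values would remain beyond it on that side, leaving at most
one sign change. -/
lemma interval_inside {n : ℕ} {T A : ℕ → ℤ} {σ τ : ℤ} {i j m M : ℕ}
    (hT : VanishingMoments n T) (hne : ∃ k, T k ≠ 0) (hσ : σ = 1 ∨ σ = -1) (hτ : τ = 1 ∨ τ = -1)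
    (hA0 : ∀ k, 0 ≤ σ * A k) (hA1 : ∀ k, σ * A k ≤ 1) (hA : ∀ k, ¬(i < k ∧ k ≤ j) → A k = 0)
    (hF : ∀ k, T k = A k + if m < k ∧ k ≤ M then τ else 0) :
    τ = -σ ∧ i < m ∧ m < M ∧ M < j := by
  have hz : ∀ (ρ : ℤ) (c : ℕ), (ρ = 1 ∨ ρ = -1) → (∀ k < c, ρ * T k ≤ 0) →
      (∀ k, c ≤ k → 0 ≤ ρ * T k) → False := by
    intro ρ c hρ h1 h2
    obtain ⟨k, hk⟩ := hne
    exact hk (hT.eq_zero hρ c h1 h2 k)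
  have hin : ∀ k, m < k → k ≤ M → T k = A k + τ := fun k h1 h2 => by rw [hF, if_pos ⟨h1, h2⟩]
  have hout : ∀ k, ¬(m < k ∧ k ≤ M) → T k = A k := fun k h => by rw [hF, if_neg h, add_zero]
  have hmM : m < M := by
    by_contra h
    refine hz σ 0 hσ (fun k hk => by omega) (fun k _ => ?_)
    rw [hout k (by omega)]
    exact hA0 k
  have hτσ : τ = -σ := by
    by_contra h
    obtain rfl : τ = σ := by omega
    refine hz τ 0 hσ (fun k hk => by omega) (fun k _ => ?_)
    have := hA0 k
    by_cases hk : m < k ∧ k ≤ M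
    · rw [hin k hk.1 hk.2]
      rcases hσ with rfl | rfl <;> omega
    · rw [hout k hk]
      exact this
  subst hτσ
  have hneg : ∀ k, m < k → k ≤ M → σ * T k ≤ 0 := by
    intro k h1 h2
    have := hA1 k
    rw [hin k h1 h2]
    rcases hσ with rfl | rfl <;> omega
  refine ⟨rfl, ?_, hmM, ?_⟩
  · by_contra h
    refine hz σ (M + 1) hσ (fun k hk => ?_) (fun k hk => ?_)
    · rcases le_or_gt k m with h' | h'
      · rw [hout k (by omega), hA k (by omega), mul_zero]
      · exact hneg k h' (by omega)
    · rw [hout k (by omega)]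
      exact hA0 k
  · by_contra h
    refine hz (-σ) (m + 1) (by omega) (fun k hk => ?_) (fun k hk => ?_)
    · rw [hout k (by omega)]
      linarith [hA0 k]
    · rcases le_or_gt k M with h' | h'
      · linarith [hneg k (by omega) h']
      · rw [hout k (by omega), hA k (by omega), mul_zero]

lemma exists_straddle {n : ℕ} {x y z : ℕ → ℤ} {i j s t : ℕ} {α β : ℤ}
    (hx01 : ∀ k, x k = 0 ∨ x k = 1) (hy01 : ∀ k, y k = 0 ∨ y k = 1)
    (hT : VanishingMoments n (prefixDiff x y)) (hne : ∃ k, prefixDiff x y k ≠ 0) (hij : i ≤ j)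
    (hα : α = -1 ∨ α = 0 ∨ α = 1) (hβ : β = -1 ∨ β = 0 ∨ β = 1)
    (hx : DelSub x z i s α) (hy : DelSub y z j t β) :
    y j = x i ∧ β = α ∧ (α = 1 ∨ α = -1) ∧
      ((α = 2 * y j - 1 ∧ Straddle y (prefixDiff x y) (2 * y j - 1) i j (t + 1) (s + 1)) ∨
        (α = -(2 * y j - 1) ∧
          Straddle y (prefixDiff x y) (2 * y j - 1) i j (s + 1) (t + 1))) := by
  have hF := prefixDiff_eq hij hx hy
  set T := prefixDiff x y with hTdef
  -- Evaluated beyond `n` and all positions involved, where every step function is fully switched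
  -- on.
  have htot : x i - y j + α - β = 0 := by
    have h0 := hF (n + i + j + s + t + 3)
    rw [hT.zero_of_le _ (by omega), if_neg (by omega), if_pos (by unfold liftPos; split_ifs <;> omega),
      if_pos (by unfold liftPos; split_ifs <;> omega), if_pos (by omega)] at h0
    omega
  have hxi := hx01 i
  have hyj := hy01 j
  have hσ : 2 * x i - 1 = 1 ∨ 2 * x i - 1 = -1 := by omega
  -- Whenever the three steps, whose heights sum to 0, merge into one interval of height `τ`,
  -- `interval_inside` applies with the deletion term as `A`.
  have key : ∀ (τ : ℤ) (m M : ℕ), (τ = 1 ∨ τ = -1) →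
      (∀ k, (if liftPos i s < k then α else 0) - (if liftPos i t < k then β else 0) +
        (if j < k then x i - y j else 0) = if m < k ∧ k ≤ M then τ else 0) →
      (τ = -(2 * x i - 1) ∧ i < m ∧ m < M ∧ M < j) ∧
      ∀ k, T k = (if i < k ∧ k ≤ j then x i - y (k - 1) else 0) +
        if m < k ∧ k ≤ M then τ else 0 := by
    intro τ m M hτ h
    have hF2 : ∀ k, T k = (if i < k ∧ k ≤ j then x i - y (k - 1) else 0) +
        if m < k ∧ k ≤ M then τ else 0 := fun k => by rw [← h k, hF k]; ring
    refine ⟨interval_inside hT hne hσ hτ (fun k => ?_) (fun k => ?_) (fun k hk => if_neg hk) hF2,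
      hF2⟩
    · have := hy01 (k - 1)
      split_ifs
      · rcases hxi with h | h <;> rw [h] <;> omega
      · simp
    · have := hy01 (k - 1)
      split_ifs
      · rcases hxi with h | h <;> rw [h] <;> omega
      · simp
  generalize hp : liftPos i s = p at key
  generalize hr : liftPos i t = r at key
  have hsp : i < p → p = s + 1 := by rw [← hp]; unfold liftPos; split_ifs <;> omega
  have htr : i < r → r = t + 1 := by rw [← hr]; unfold liftPos; split_ifs <;> omega
  -- a single substitution cannot compensate
  have hα0 : α ≠ 0 := by
    intro h0
    by_cases hb : β = 0
    · have := (key 1 0 0 (by simp) (fun k => by split_ifs <;> omega)).1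
      omega
    · rcases le_total r j with h | h
      · have := (key (-β) r j (by omega) (fun k => by split_ifs <;> omega)).1
        omega
      · have := (key β j r (by omega) (fun k => by split_ifs <;> omega)).1
        omega
  have hβ0 : β ≠ 0 := by
    intro h0
    rcases le_total p j with h | h
    · have := (key α p j (by omega) (fun k => by split_ifs <;> omega)).1
      omega
    · have := (key (-α) j p (by omega) (fun k => by split_ifs <;> omega)).1
      omega
  obtain rfl : β = α := by omega
  have hxy : y j = x i := by omega
  refine ⟨hxy, rfl, by omega, ?_⟩
  rw [hxy]
  rcases le_total r p with h | h
  · obtain ⟨h1, h2⟩ := key (-β) r p (by omega) (fun k => by split_ifs <;> omega)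
    left
    rw [← hsp (by omega), ← htr (by omega)]
    refine ⟨by omega, by omega, by omega, by omega, by omega, fun k => ?_⟩
    rw [h2 k, hxy]
    split_ifs <;> omega
  · obtain ⟨h1, h2⟩ := key β p r (by omega) (fun k => by split_ifs <;> omega)
    right
    rw [← hsp (by omega), ← htr (by omega)]
    refine ⟨by omega, by omega, by omega, by omega, by omega, fun k => ?_⟩
    rw [h2 k, hxy]
    split_ifs <;> omega

/-- The corrected interval is determined by `y` and `T`. -/
lemma Straddle.interval_unique {n : ℕ} {y T : ℕ → ℤ} {σ : ℤ} {i j p q i' j' p' q' : ℕ}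
    (h : Straddle y T σ i j p q) (h' : Straddle y T σ i' j' p' q')
    (hy : ∀ k, y k = 0 ∨ y k = 1) (hT : VanishingMoments n T) (hne : ∃ k, T k ≠ 0) :
    p = p' ∧ q = q' ∧ i' < j ∧ i < j' := by
  have hσ : σ = 1 ∨ σ = -1 := by have := hy j; have := h.entry; omega
  have hs := h.signPattern hy
  have hs' := h'.signPattern hy
  obtain ⟨k₀, hk₀, hpos₀⟩ := hs.exists_pos_left hT hne hσ
  obtain ⟨k₁, hk₁, hpos₁⟩ := hs.exists_pos_right hT hne hσ
  obtain ⟨k₂, hk₂, hk₂', hneg⟩ := hs.exists_neg hT hne hσ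
  have mem : ∀ k, 0 < σ * T k → (i < k ∧ k ≤ j) ∧ (i' < k ∧ k ≤ j') ∧ ¬(p' < k ∧ k ≤ q') := by
    intro k hk
    refine ⟨?_, ?_, fun hc => by linarith [hs'.1 k hc.1 hc.2]⟩
    · by_contra hc
      have := h.lt_left
      have := h.le_right
      rw [h.eq k, if_neg hc, if_neg (by omega)] at hk
      simp at hk
    · by_contra hc
      have := h'.lt_left
      have := h'.le_right
      rw [h'.eq k, if_neg hc, if_neg (by omega)] at hk
      simp at hk
  have hmid : p' < k₂ ∧ k₂ ≤ q' := by
    by_contra hc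
    linarith [hs'.2 k₂ hc]
  obtain ⟨a1, a2, a3⟩ := mem k₀ hpos₀
  obtain ⟨b1, b2, b3⟩ := mem k₁ hpos₁
  -- Between `k₀` and `k₁` both moves are active and shift equal entries, so their contributions
  -- cancel and only the interval indicators are compared. All four endpoints fall in this range.
  have hiff : ∀ k, k₀ ≤ k → k ≤ k₁ → ((p < k ∧ k ≤ q) ↔ (p' < k ∧ k ≤ q')) := by
    intro k h1 h2
    have e := (h.eq k).symm.trans (h'.eq k)
    have f := h.entry
    have f' := h'.entry
    rw [if_pos (by omega : i < k ∧ k ≤ j), if_pos (by omega : i' < k ∧ k ≤ j')] at e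
    have e' : (if p < k ∧ k ≤ q then σ else 0) = if p' < k ∧ k ≤ q' then σ else 0 := by linarith
    have hσ0 : σ ≠ 0 := by omega
    by_cases c : p < k ∧ k ≤ q
    · rw [if_pos c] at e'
      exact iff_of_true c (by_contra fun c' => hσ0 (by rw [e', if_neg c']))
    · rw [if_neg c] at e'
      exact iff_of_false c fun c' => hσ0 (by rw [if_pos c'] at e'; exact e'.symm)
  have c1 := hiff (p + 1) (by omega) (by omega)
  have c2 := hiff (p' + 1) (by omega) (by omega)
  have c3 := hiff q (by omega) (by omega)
  have c4 := hiff q' (by omega) (by omega)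
  have := h.lt_mid
  have := h'.lt_mid
  omega

/-- Between the endpoints of two moves into the same sequence, that sequence is constant. -/
lemma Straddle.const_between {y T : ℕ → ℤ} {σ : ℤ} {i j p q i' j' : ℕ}
    (h : Straddle y T σ i j p q) (h' : Straddle y T σ i' j' p q) (hij : i' < j)
    {k : ℕ} (hk : j ≤ k) (hk' : k ≤ j') : y k = y j' := by
  rcases hk'.eq_or_lt with rfl | hlt
  · rfl
  have e := (h.eq (k + 1)).symm.trans (h'.eq (k + 1))
  rw [if_neg (by omega), if_pos (by omega : i' < k + 1 ∧ k + 1 ≤ j'), Nat.add_sub_cancel] at e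
  linarith

lemma DelSub.eq_of_const {y z w : ℕ → ℤ} {j j' t : ℕ} {β : ℤ} (h : DelSub y z j t β)
    (h' : DelSub y w j' t β) (hle : j ≤ j') (hc : ∀ k, j ≤ k → k ≤ j' → y k = y j') : z = w := by
  funext k
  rcases lt_or_ge k j with h1 | h1
  · linarith [h.1 k h1, h'.1 k (by omega)]
  · rcases lt_or_ge k j' with h2 | h2
    · linarith [h.2 k h1, h'.1 k h2, hc k h1 h2.le, hc (k + 1) (by omega) h2]
    · linarith [h.2 k h1, h'.2 k h2]

/-- Two common descendants of `x` and `y`, obtained by moves in the same direction and of the same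
kind, agree. -/
lemma eq_of_same_direction {n : ℕ} {x y z w : ℕ → ℤ} {i j s t i' j' s' t' : ℕ} {α β α' β' : ℤ}
    (hx01 : ∀ k, x k = 0 ∨ x k = 1) (hy01 : ∀ k, y k = 0 ∨ y k = 1)
    (hT : VanishingMoments n (prefixDiff x y)) (hne : ∃ k, prefixDiff x y k ≠ 0)
    (hij : i ≤ j) (hij' : i' ≤ j')
    (hα : α = -1 ∨ α = 0 ∨ α = 1) (hβ : β = -1 ∨ β = 0 ∨ β = 1)
    (hα' : α' = -1 ∨ α' = 0 ∨ α' = 1) (hβ' : β' = -1 ∨ β' = 0 ∨ β' = 1)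
    (hx : DelSub x z i s α) (hy : DelSub y z j t β)
    (hx' : DelSub x w i' s' α') (hy' : DelSub y w j' t' β')
    (hj : y j = y j') (hαα : α = α') : z = w := by
  obtain ⟨-, rfl, hα1, h⟩ := exists_straddle hx01 hy01 hT hne hij hα hβ hx hy
  obtain ⟨-, rfl, -, h'⟩ := exists_straddle hx01 hy01 hT hne hij' hα' hβ' hx' hy'
  subst hαα
  rw [← hj] at h'
  have finish : ∀ {p q : ℕ}, Straddle y (prefixDiff x y) (2 * y j - 1) i j p q →
      Straddle y (prefixDiff x y) (2 * y j - 1) i' j' p q → i' < j → i < j' → t = t' → z = w := by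
    rintro p q S S' h1 h2 rfl
    rcases le_total j j' with hl | hl
    · exact hy.eq_of_const hy' hl (fun k hk hk' => S.const_between S' h1 hk hk')
    · exact (hy'.eq_of_const hy hl (fun k hk hk' => S'.const_between S h2 hk hk')).symm
  -- Whether `α` is `σ` or `-σ` decides which substitution opens the interval, so the mixed cases
  -- are contradictory.
  rcases h with ⟨e, S⟩ | ⟨e, S⟩ <;> rcases h' with ⟨e', S'⟩ | ⟨e', S'⟩
  · obtain ⟨h1, h2, h3, h4⟩ := S.interval_unique S' hy01 hT hne
    rw [← h1, ← h2] at S'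
    exact finish S S' h3 h4 (by omega)
  · omega
  · omega
  · obtain ⟨h1, h2, h3, h4⟩ := S.interval_unique S' hy01 hT hne
    rw [← h1, ← h2] at S'
    exact finish S S' h3 h4 (by omega)

/-- `z` arises from `x` by deleting one of the first `n` entries and changing at most one entry
by at most one. -/
def IsDescendant (n : ℕ) (x z : ℕ → ℤ) : Prop :=
  ∃ i s α, i < n ∧ (α = -1 ∨ α = 0 ∨ α = 1) ∧ DelSub x z i s α

lemma eq_of_sum_eq {n : ℕ} {x y z w : ℕ → ℤ}
    (hx01 : ∀ k, x k = 0 ∨ x k = 1) (hy01 : ∀ k, y k = 0 ∨ y k = 1)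
    (hT : VanishingMoments n (prefixDiff x y)) (hne : ∃ k, prefixDiff x y k ≠ 0)
    (hz : IsDescendant n x z) (hz' : IsDescendant n y z)
    (hw : IsDescendant n x w) (hw' : IsDescendant n y w)
    (hsum : ∀ N, n ≤ N → ∑ l ∈ Finset.range N, z l = ∑ l ∈ Finset.range N, w l) : z = w := by
  obtain ⟨i, s, α, hi, hα, hx⟩ := hz
  obtain ⟨j, t, β, hj, hβ, hy⟩ := hz'
  obtain ⟨i', s', α', hi', hα', hx'⟩ := hw
  obtain ⟨j', t', β', hj', hβ', hy'⟩ := hw'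
  have hT' : VanishingMoments n (prefixDiff y x) := by
    have : prefixDiff y x = fun k => -prefixDiff x y k := funext (prefixDiff_swap x y)
    rw [this]
    exact hT.neg
  have hne' : ∃ k, prefixDiff y x k ≠ 0 := by
    obtain ⟨k, hk⟩ := hne
    exact ⟨k, by rw [prefixDiff_swap]; simpa using hk⟩
  have hsw : x i + α = x i' + α' := by
    have h1 := hx.sum_range_eq (n + s + s' + 1) (by omega)
    have h2 := hx'.sum_range_eq (n + s + s' + 1) (by omega)
    rw [hsum _ (by omega), if_pos (by omega)] at h1
    rw [if_pos (by omega)] at h2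
    linarith
  have info : ∀ {u : ℕ → ℤ} {i s j t : ℕ} {α β : ℤ}, (α = -1 ∨ α = 0 ∨ α = 1) →
      (β = -1 ∨ β = 0 ∨ β = 1) → DelSub x u i s α → DelSub y u j t β →
      y j = x i ∧ β = α ∧ (α = 1 ∨ α = -1) ∧
      ((i ≤ j ∧ ∃ p q, SignPattern (prefixDiff x y) (2 * x i - 1) p q) ∨
        (j ≤ i ∧ ∃ p q, SignPattern (prefixDiff x y) (-(2 * x i - 1)) p q)) := by
    intro u i s j t α β hα hβ hx hy
    rcases le_total i j with hij | hij
    · obtain ⟨h1, h2, h3, h4⟩ := exists_straddle hx01 hy01 hT hne hij hα hβ hx hy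
      rw [h1] at h4
      refine ⟨h1, h2, h3, Or.inl ⟨hij, ?_⟩⟩
      rcases h4 with ⟨-, S⟩ | ⟨-, S⟩ <;> exact ⟨_, _, S.signPattern hy01⟩
    · obtain ⟨h1, h2, h3, h4⟩ := exists_straddle hy01 hx01 hT' hne' hij hβ hα hy hx
      refine ⟨h1.symm, h2.symm, by omega, Or.inr ⟨hij, ?_⟩⟩
      have : ∀ p q, SignPattern (prefixDiff y x) (2 * x i - 1) p q →
          SignPattern (prefixDiff x y) (-(2 * x i - 1)) p q := by
        intro p q h
        simpa only [SignPattern, prefixDiff_swap x y, mul_neg, neg_mul] using h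
      rcases h4 with ⟨-, S⟩ | ⟨-, S⟩ <;> exact ⟨_, _, this _ _ (S.signPattern hx01)⟩
  obtain ⟨a1, a2, a3, a4⟩ := info hα hβ hx hy
  obtain ⟨b1, b2, b3, b4⟩ := info hα' hβ' hx' hy'
  have c1 := hx01 i
  have c2 := hx01 i'
  -- With `x i` in `{0, 1}` and `α = ±1`, the sum `x i + α` takes the distinct values -1, 0, 1, 2.
  have hxi : x i = x i' := by omega
  have hαα : α = α' := by omega
  rw [← hxi] at b4
  have hσ : 2 * x i - 1 = 1 ∨ 2 * x i - 1 = -1 := by omega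
  rcases a4 with ⟨hij, p, q, S⟩ | ⟨hij, p, q, S⟩ <;>
    rcases b4 with ⟨hij', p', q', S'⟩ | ⟨hij', p', q', S'⟩
  · exact eq_of_same_direction hx01 hy01 hT hne hij hij' hα hβ hα' hβ' hx hy hx' hy'
      (by omega) hαα
  · exact (S.not_opposite S' hT hne hσ).elim
  · exact (S'.not_opposite S hT hne hσ).elim
  · exact eq_of_same_direction hy01 hx01 hT' hne' hij hij' hβ hα hβ' hα' hy hx hy' hx'
      hxi (by omega)

/-! ### Binary sequences as integer sequences -/

namespace BinSeq

/-- The entries of `x` as integers, continued by zeros. -/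
def toIntSeq {n : ℕ} (x : BinSeq n) (k : ℕ) : ℤ := if h : k < n then ((x ⟨k, h⟩).toNat : ℤ) else 0

lemma toIntSeq_eq_zero_or_one {n : ℕ} (x : BinSeq n) (k : ℕ) :
    x.toIntSeq k = 0 ∨ x.toIntSeq k = 1 := by
  unfold toIntSeq
  split_ifs with h
  · cases x ⟨k, h⟩ <;> simp
  · simp

lemma toIntSeq_of_le {n : ℕ} (x : BinSeq n) {k : ℕ} (hk : n ≤ k) : x.toIntSeq k = 0 :=
  dif_neg (by omega)

lemma toIntSeq_val {n : ℕ} (x : BinSeq n) (i : Fin n) : x.toIntSeq i = ((x i).toNat : ℤ) :=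
  dif_pos i.2

lemma toIntSeq_injective {n : ℕ} : Function.Injective (toIntSeq (n := n)) := by
  intro x y h
  funext i
  have := congrFun h i
  rw [toIntSeq_val, toIntSeq_val] at this
  cases hx : x i <;> cases hy : y i <;> simp_all

lemma sum_toIntSeq_of_le {n N : ℕ} (x : BinSeq n) (h : n ≤ N) :
    ∑ l ∈ Finset.range N, x.toIntSeq l = (x.weight : ℤ) := by
  rw [← Finset.sum_subset (Finset.range_mono h)
    (fun k _ hk => x.toIntSeq_of_le (by simpa using hk)), Finset.sum_range, weight, Nat.cast_sum]
  exact Finset.sum_congr rfl fun i _ => x.toIntSeq_val i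

/-- The range misses exactly one point, and a strictly monotone map is determined by its range. -/
lemma exists_succAbove_of_strictMono {m : ℕ} {f : Fin m → Fin (m + 1)} (hf : StrictMono f) :
    ∃ i : Fin (m + 1), f = i.succAbove := by
  obtain ⟨i, hi⟩ : ∃ i, i ∉ Set.range f := by
    by_contra! h
    have := Fintype.card_le_of_surjective f h
    simp at this
  refine ⟨i, (StrictMono.range_inj hf (Fin.strictMono_succAbove i)).1 ?_⟩
  rw [Fin.range_succAbove]
  have hsub : Set.range f ⊆ {i}ᶜ := fun a ha hai => hi (hai ▸ ha)
  refine Set.eq_of_subset_of_ncard_le hsub ?_ (Set.toFinite _)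
  rw [Set.ncard_compl, Set.ncard_range_of_injective hf.injective]
  simp

lemma exists_delSub {m : ℕ} {x : BinSeq (m + 1)} {z : BinSeq m}
    (h : ∃ y : BinSeq m, IsSubsequence y x ∧ hammingDist y z ≤ 1) :
    IsDescendant (m + 1) x.toIntSeq z.toIntSeq := by
  obtain ⟨y, ⟨f, hf, hy⟩, hd⟩ := h
  obtain ⟨i, rfl⟩ := exists_succAbove_of_strictMono hf
  obtain ⟨s, hs⟩ : ∃ s : ℕ, ∀ k, k ≠ s → y.toIntSeq k = z.toIntSeq k := by
    rw [hammingDist, Finset.card_le_one] at hd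
    by_cases hne : ∃ a, y a ≠ z a
    · obtain ⟨a, ha⟩ := hne
      refine ⟨a, fun k hk => ?_⟩
      unfold toIntSeq
      split_ifs with hkm
      · by_contra hc
        have : y ⟨k, hkm⟩ ≠ z ⟨k, hkm⟩ := fun e => hc (by rw [e])
        exact hk (congrArg Fin.val (hd ⟨k, hkm⟩ (by simpa using this) a (by simpa using ha)))
      · rfl
    · push Not at hne
      -- With no substitution the position is arbitrary, as `α` will be 0.
      exact ⟨0, fun k _ => by rw [funext hne]⟩
  have h1 := y.toIntSeq_eq_zero_or_one s
  have h2 := z.toIntSeq_eq_zero_or_one s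
  have hyz : ∀ k, y.toIntSeq k =
      z.toIntSeq k + if k = s then y.toIntSeq s - z.toIntSeq s else 0 := by
    intro k
    split_ifs with hk
    · subst hk; ring
    · rw [hs k hk, add_zero]
  refine ⟨i, s, y.toIntSeq s - z.toIntSeq s, i.2, by omega, fun k hk => ?_, fun k hk => ?_⟩
  · have hi := i.2
    rw [← hyz, toIntSeq, toIntSeq, dif_pos (by omega), dif_pos (by omega), hy,
      Fin.succAbove_of_castSucc_lt _ _ (by simpa [Fin.lt_def] using hk)]
    rfl
  · rw [← hyz, toIntSeq, toIntSeq]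
    by_cases hkm : k < m
    · rw [dif_pos (by omega), dif_pos hkm, hy,
        Fin.succAbove_of_le_castSucc _ _ (by simpa [Fin.le_def] using hk)]
      rfl
    · rw [dif_neg (by omega), dif_neg hkm]

/-! ### Syndromes and prefix sums -/

lemma sum_succ_mul (x : ℕ → ℤ) (n : ℕ) :
    ∑ l ∈ Finset.range n, ((l : ℤ) + 1) * x l =
      n * ∑ l ∈ Finset.range n, x l -
        ∑ k ∈ Finset.range n, ∑ l ∈ Finset.range k, x l := by
  induction n with
  | zero => simp
  | succ n ih =>
    rw [Finset.sum_range_succ, ih, Finset.sum_range_succ _ n, Finset.sum_range_succ _ n]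
    push_cast
    ring

lemma two_mul_sum_triangular_mul (x : ℕ → ℤ) (n : ℕ) :
    2 * ∑ l ∈ Finset.range n, (∑ j ∈ Finset.Icc 1 (l + 1), (j : ℤ)) * x l =
      n * (n + 1) * ∑ l ∈ Finset.range n, x l -
        2 * ∑ k ∈ Finset.range n, ((k : ℤ) + 1) * ∑ l ∈ Finset.range k, x l := by
  have tri : ∀ l : ℕ, 2 * ∑ j ∈ Finset.Icc 1 (l + 1), (j : ℤ) = ((l : ℤ) + 1) * (l + 2) := by
    intro l
    induction l with
    | zero => simp
    | succ l ih =>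
      rw [Finset.sum_Icc_succ_top (by omega), mul_add, ih]
      push_cast
      ring
  induction n with
  | zero => simp
  | succ n ih =>
    rw [Finset.sum_range_succ, mul_add, ih, Finset.sum_range_succ _ n, Finset.sum_range_succ _ n,
      ← mul_assoc, tri]
    push_cast
    ring

lemma vtSyndrome_one_eq {n : ℕ} (x : BinSeq n) :
    (x.vtSyndrome 1 : ℤ) = ∑ l ∈ Finset.range n, ((l : ℤ) + 1) * x.toIntSeq l := by
  rw [Finset.sum_range, vtSyndrome]
  push_cast
  refine Finset.sum_congr rfl fun i _ => ?_
  rw [toIntSeq_val]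
  simp

lemma vtSyndrome_two_eq {n : ℕ} (x : BinSeq n) :
    (x.vtSyndrome 2 : ℤ) =
      ∑ l ∈ Finset.range n, (∑ j ∈ Finset.Icc 1 (l + 1), (j : ℤ)) * x.toIntSeq l := by
  rw [Finset.sum_range, vtSyndrome]
  push_cast
  refine Finset.sum_congr rfl fun i _ => ?_
  rw [toIntSeq_val, Finset.sum_mul]
  simp

lemma prefixDiff_eq_sub (x y : ℕ → ℤ) (k : ℕ) : prefixDiff x y k =
    ∑ l ∈ Finset.range k, x l - ∑ l ∈ Finset.range k, y l := Finset.sum_sub_distrib _ _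

/-- Two descendants meeting forces the prefix sums to be close. -/
lemma abs_prefixDiff_le {n : ℕ} {x y z : ℕ → ℤ} {i j s t : ℕ} {α β : ℤ}
    (hx01 : ∀ k, x k = 0 ∨ x k = 1) (hy01 : ∀ k, y k = 0 ∨ y k = 1)
    (hconst : ∀ k, n ≤ k → prefixDiff x y k = prefixDiff x y n)
    (h4 : (4 : ℤ) ∣ prefixDiff x y n) (hij : i ≤ j)
    (hα : α = -1 ∨ α = 0 ∨ α = 1) (hβ : β = -1 ∨ β = 0 ∨ β = 1)
    (hx : DelSub x z i s α) (hy : DelSub y z j t β) :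
    prefixDiff x y n = 0 ∧ ∀ k, |prefixDiff x y k| ≤ 2 := by
  have hF := prefixDiff_eq hij hx hy
  have hxi := hx01 i
  have hyj := hy01 j
  have htot : prefixDiff x y n = x i - y j + α - β := by
    rw [← hconst (n + i + j + s + t + 3) (by omega), hF, if_neg (by omega),
      if_pos (by unfold liftPos; split_ifs <;> omega),
      if_pos (by unfold liftPos; split_ifs <;> omega), if_pos (by omega)]
    ring
  -- The total lies in `[-3, 3]` and is divisible by 4. Its vanishing gives `|α - β| ≤ 1`, whence
  -- the bound 2 instead of 3.
  have h0 : prefixDiff x y n = 0 := by omega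
  refine ⟨h0, fun k => ?_⟩
  have hyk := hy01 (k - 1)
  rw [hF k, abs_le]
  split_ifs <;> omega

lemma vanishingMoments_prefixDiff {n : ℕ} {x y : BinSeq n} (hn : 1 ≤ n)
    (h0 : x.vtSyndrome 0 ≡ y.vtSyndrome 0 [MOD 4])
    (h1 : x.vtSyndrome 1 ≡ y.vtSyndrome 1 [MOD 2 * n])
    (h2 : x.vtSyndrome 2 ≡ y.vtSyndrome 2 [MOD 2 * n ^ 2])
    {z : ℕ → ℤ} (hx : IsDescendant n x.toIntSeq z) (hy : IsDescendant n y.toIntSeq z) :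
    VanishingMoments n (prefixDiff x.toIntSeq y.toIntSeq) := by
  set T := prefixDiff x.toIntSeq y.toIntSeq with hT
  have hTk : ∀ k, T k = ∑ l ∈ Finset.range k, x.toIntSeq l - ∑ l ∈ Finset.range k, y.toIntSeq l :=
    prefixDiff_eq_sub _ _
  have hconst : ∀ k, n ≤ k → T k = T n := by
    intro k hk
    simp only [hTk, sum_toIntSeq_of_le _ hk, sum_toIntSeq_of_le _ le_rfl]
  have h4 : (4 : ℤ) ∣ T n := by
    rw [hTk, sum_toIntSeq_of_le _ le_rfl, sum_toIntSeq_of_le _ le_rfl]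
    exact_mod_cast h0.symm.dvd
  obtain ⟨hTn, hbd⟩ : T n = 0 ∧ ∀ k, |T k| ≤ 2 := by
    obtain ⟨i, s, α, -, hα, hx⟩ := hx
    obtain ⟨j, t, β, -, hβ, hy⟩ := hy
    rcases le_total i j with hij | hij
    · exact abs_prefixDiff_le x.toIntSeq_eq_zero_or_one y.toIntSeq_eq_zero_or_one hconst h4 hij
        hα hβ hx hy
    · have := abs_prefixDiff_le (n := n) y.toIntSeq_eq_zero_or_one x.toIntSeq_eq_zero_or_one
        (fun k hk => by rw [prefixDiff_swap, prefixDiff_swap x.toIntSeq, ← hT, hconst k hk])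
        (by rw [prefixDiff_swap]; exact (dvd_neg).2 h4) hij hβ hα hy hx
      simpa only [prefixDiff_swap x.toIntSeq y.toIntSeq, neg_eq_zero, abs_neg] using this
  have hT0 : T 0 = 0 := by simp [hT, prefixDiff]
  obtain ⟨m, rfl⟩ : ∃ m, n = m + 1 := ⟨n - 1, by omega⟩
  have hsum : (x.weight : ℤ) = y.weight := by
    have := hTk (m + 1)
    rw [hTn, sum_toIntSeq_of_le _ le_rfl, sum_toIntSeq_of_le _ le_rfl] at this
    linarith
  refine ⟨fun k hk => by rw [hconst k hk, hTn], ?_, ?_⟩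
  · have hd : (2 * ((m : ℤ) + 1)) ∣ ∑ k ∈ Finset.range (m + 1), T k := by
      have hd := h1.dvd
      rw [vtSyndrome_one_eq, vtSyndrome_one_eq, sum_succ_mul, sum_succ_mul,
        sum_toIntSeq_of_le _ le_rfl, sum_toIntSeq_of_le _ le_rfl, hsum] at hd
      have e : ∑ k ∈ Finset.range (m + 1), T k =
        ∑ k ∈ Finset.range (m + 1), ∑ l ∈ Finset.range k, x.toIntSeq l -
          ∑ k ∈ Finset.range (m + 1), ∑ l ∈ Finset.range k, y.toIntSeq l := by
        rw [← Finset.sum_sub_distrib]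
        exact Finset.sum_congr rfl fun k _ => hTk k
      rw [e]
      push_cast at hd
      convert hd using 1
      ring
    -- Since `T 0 = 0`, only `n - 1` terms of size at most 2 count, which makes the inequality
    -- strict.
    refine Int.eq_zero_of_abs_lt_dvd hd ?_
    rw [Finset.sum_range_succ', hT0, add_zero]
    calc |∑ k ∈ Finset.range m, T (k + 1)| ≤ ∑ k ∈ Finset.range m, |T (k + 1)| :=
          Finset.abs_sum_le_sum_abs _ _
      _ ≤ ∑ _k ∈ Finset.range m, 2 := Finset.sum_le_sum fun k _ => hbd _
      _ < 2 * ((m : ℤ) + 1) := by simp; omega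
  · have hd : (2 * ((m : ℤ) + 1) ^ 2) ∣ ∑ k ∈ Finset.range (m + 1), ((k : ℤ) + 1) * T k := by
      have hd := h2.dvd
      have e : ∑ k ∈ Finset.range (m + 1), ((k : ℤ) + 1) * T k =
        ∑ k ∈ Finset.range (m + 1), ((k : ℤ) + 1) * ∑ l ∈ Finset.range k, x.toIntSeq l -
          ∑ k ∈ Finset.range (m + 1), ((k : ℤ) + 1) * ∑ l ∈ Finset.range k, y.toIntSeq l := by
        rw [← Finset.sum_sub_distrib]
        exact Finset.sum_congr rfl fun k _ => by rw [hTk k]; ring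
      have ex := two_mul_sum_triangular_mul x.toIntSeq (m + 1)
      have ey := two_mul_sum_triangular_mul y.toIntSeq (m + 1)
      rw [← vtSyndrome_two_eq, sum_toIntSeq_of_le _ le_rfl] at ex ey
      rw [hsum] at ex
      have : (y.vtSyndrome 2 : ℤ) - x.vtSyndrome 2 =
          ∑ k ∈ Finset.range (m + 1), ((k : ℤ) + 1) * T k := by
        rw [e]; linarith
      rw [← this]
      exact_mod_cast hd
    refine Int.eq_zero_of_abs_lt_dvd hd ?_
    rw [Finset.sum_range_succ', hT0, mul_zero, add_zero]
    have hsq : ∀ m : ℕ, ∑ k ∈ Finset.range m, 2 * ((k : ℤ) + 2) = m * (m + 3) := by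
      intro m
      induction m with
      | zero => simp
      | succ m ih => rw [Finset.sum_range_succ, ih]; push_cast; ring
    calc |∑ k ∈ Finset.range m, (((k + 1 : ℕ) : ℤ) + 1) * T (k + 1)|
        ≤ ∑ k ∈ Finset.range m, |(((k + 1 : ℕ) : ℤ) + 1) * T (k + 1)| :=
          Finset.abs_sum_le_sum_abs _ _
      _ ≤ ∑ k ∈ Finset.range m, 2 * ((k : ℤ) + 2) := Finset.sum_le_sum fun k _ => by
          rw [abs_mul, abs_of_nonneg (by positivity)]
          push_cast
          nlinarith [hbd (k + 1)]
      _ = m * (m + 3) := hsq m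
      _ < 2 * ((m : ℤ) + 1) ^ 2 := by nlinarith

lemma weight_mem_of_isDescendant {m : ℕ} {x : BinSeq (m + 1)} {z : BinSeq m}
    (h : IsDescendant (m + 1) x.toIntSeq z.toIntSeq) :
    x.weight ≤ z.weight + 2 ∧ z.weight ≤ x.weight + 1 := by
  obtain ⟨i, s, α, hi, hα, hx⟩ := h
  have e := hx.sum_range_eq (m + i + s + 1) (by omega)
  rw [sum_toIntSeq_of_le _ (by omega), sum_toIntSeq_of_le _ (by omega), if_pos (by omega)] at e
  have := x.toIntSeq_eq_zero_or_one i
  omega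

end BinSeq

/-! ### Counting common descendants and choosing the residues -/

open BinSeq

/-- Sequences with congruent syndromes have at most four common descendants. -/
lemma isReconstructionCode_listDecodableCode {n : ℕ} (hn : 1 ≤ n) (s₀ s₁ s₂ : ℕ) :
    IsReconstructionCode n 5 (listDecodableCode n s₀ s₁ s₂) := by
  rintro x ⟨hx0, hx1, hx2⟩ y ⟨hy0, hy1, hy2⟩ hxy
  obtain ⟨m, rfl⟩ : ∃ m, n = m + 1 := ⟨n - 1, by omega⟩
  have h1 : x.vtSyndrome 1 ≡ y.vtSyndrome 1 [MOD 2 * (m + 1)] := by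
    simpa using hx1.trans hy1.symm
  have desc : ∀ {x : BinSeq (m + 1)} {z : BinSeq m}, z ∈ x.deletionSubstitutionBall →
      IsDescendant (m + 1) x.toIntSeq z.toIntSeq := fun h => exists_delSub h
  have hne : ∃ k, prefixDiff x.toIntSeq y.toIntSeq k ≠ 0 := by
    by_contra! hc
    refine hxy (toIntSeq_injective (funext fun k => ?_))
    have := prefixDiff_succ x.toIntSeq y.toIntSeq k
    rw [hc, hc] at this
    linarith
  have hinj : Set.InjOn weight (x.deletionSubstitutionBall ∩ y.deletionSubstitutionBall) := by
    rintro z ⟨hz, hz'⟩ w ⟨hw, hw'⟩ hzw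
    have hT := vanishingMoments_prefixDiff hn (hx0.trans hy0.symm) h1 (hx2.trans hy2.symm)
      (desc hz) (desc hz')
    refine toIntSeq_injective (eq_of_sum_eq x.toIntSeq_eq_zero_or_one y.toIntSeq_eq_zero_or_one
      hT hne (desc hz) (desc hz') (desc hw) (desc hw') fun N hN => ?_)
    rw [sum_toIntSeq_of_le z (by omega), sum_toIntSeq_of_le w (by omega), hzw]
  -- Truncated subtraction can only shrink this interval of at most four weights.
  have hle := Set.ncard_le_ncard_of_injOn (t := Set.Icc (x.weight - 2) (x.weight + 1)) weight
    (fun z hz => by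
      have := weight_mem_of_isDescendant (desc hz.1)
      exact ⟨by omega, by omega⟩) hinj (Set.toFinite _)
  rw [← Finset.coe_Icc, Set.ncard_coe_finset, Nat.card_Icc] at hle
  omega

/-- By the pigeonhole principle some residues give a code of at least average size. -/
lemma exists_listDecodableCode_redundancy_le {n : ℕ} (hn : 1 ≤ n) :
    ∃ s₀ s₁ s₂ : ℕ, s₀ < 4 ∧ s₁ < 2 * n ∧ s₂ < 2 * n ^ 2 ∧
      (listDecodableCode n s₀ s₁ s₂).Nonempty ∧
      redundancy (listDecodableCode n s₀ s₁ s₂) ≤ 3 * Real.logb 2 (n : ℝ) + 4 := by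
  classical
  have hn0 : (0 : ℝ) < n := by exact_mod_cast hn
  have hn2 : 0 < n ^ 2 := by positivity
  let f : BinSeq n → ℕ × ℕ × ℕ := fun x =>
    (x.vtSyndrome 0 % 4, x.vtSyndrome 1 % (2 * n), x.vtSyndrome 2 % (2 * n ^ 2))
  let t : Finset (ℕ × ℕ × ℕ) :=
    Finset.range 4 ×ˢ Finset.range (2 * n) ×ˢ Finset.range (2 * n ^ 2)
  have hmaps : ∀ x ∈ (Finset.univ : Finset (BinSeq n)), f x ∈ t := fun x _ => by
    simp only [f, t, Finset.mem_product, Finset.mem_range]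
    exact ⟨Nat.mod_lt _ (by omega), Nat.mod_lt _ (by omega), Nat.mod_lt _ (by omega)⟩
  have htne : t.Nonempty := ⟨(0, 0, 0), by simp [t]; omega⟩
  obtain ⟨⟨s₀, s₁, s₂⟩, hs, hcard⟩ :=
    Finset.exists_le_card_fiber_of_nsmul_le_card_of_maps_to (b := (2 : ℝ) ^ n / (16 * n ^ 3))
      hmaps htne (by
        simp only [t, Finset.card_product, Finset.card_range, nsmul_eq_mul, Finset.card_univ,
          Fintype.card_fun, Fintype.card_bool, Fintype.card_fin]
        push_cast
        apply le_of_eq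
        field_simp
        ring)
  simp only [t, Finset.mem_product, Finset.mem_range] at hs
  have hC : listDecodableCode n s₀ s₁ s₂ =
      ((Finset.univ.filter fun x => f x = (s₀, s₁, s₂) : Finset (BinSeq n)) : Set (BinSeq n)) := by
    ext x
    simp only [listDecodableCode, Set.mem_ofPred_eq, Finset.coe_filter, Finset.mem_univ, true_and,
      f, Prod.mk.injEq, Nat.ModEq, pow_one, Nat.mod_eq_of_lt hs.1, Nat.mod_eq_of_lt hs.2.1,
      Nat.mod_eq_of_lt hs.2.2]
  have hb : (0 : ℝ) < 2 ^ n / (16 * n ^ 3) := by positivity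
  have hle : (2 : ℝ) ^ n / (16 * n ^ 3) ≤ ((listDecodableCode n s₀ s₁ s₂).ncard : ℝ) := by
    rw [hC, Set.ncard_coe_finset]
    exact hcard
  refine ⟨s₀, s₁, s₂, hs.1, hs.2.1, hs.2.2, ?_, ?_⟩
  · refine Set.nonempty_of_ncard_ne_zero fun h => ?_
    rw [h, Nat.cast_zero] at hle
    linarith
  · have hlog := Real.logb_le_logb_of_le (b := 2) (by norm_num) hb hle
    have h16 : Real.logb 2 16 = 4 := by
      rw [show (16 : ℝ) = 2 ^ (4 : ℕ) by norm_num, Real.logb_pow, Real.logb_self_eq_one (by norm_num)]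
      norm_num
    rw [Real.logb_div (by positivity) (by positivity), Real.logb_mul (by positivity) (by positivity),
      Real.logb_pow, Real.logb_pow, Real.logb_self_eq_one (by norm_num), h16] at hlog
    push_cast at hlog
    unfold redundancy
    linarith

theorem theorem8 (n : ℕ) (hn : 1 ≤ n) :
    (∀ s₀ s₁ s₂ : ℕ, s₀ < 4 → s₁ < 2 * n → s₂ < 2 * n ^ 2 →
      IsReconstructionCode n 5 (listDecodableCode n s₀ s₁ s₂)) ∧
    (∃ s₀ s₁ s₂ : ℕ, s₀ < 4 ∧ s₁ < 2 * n ∧ s₂ < 2 * n ^ 2 ∧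
      (listDecodableCode n s₀ s₁ s₂).Nonempty ∧
      redundancy (listDecodableCode n s₀ s₁ s₂) ≤ 3 * Real.logb 2 (n : ℝ) + 4) :=
  ⟨fun s₀ s₁ s₂ _ _ _ => isReconstructionCode_listDecodableCode hn s₀ s₁ s₂,
    exists_listDecodableCode_redundancy_le hn⟩
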